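/- Let $0<p<1$, $q=1-p$, and let $k,r\ge 1$ and $0\le\ell\le k-1$ be integers. Consider independent Bernoulli trials, numbered $1,2,3,\dots$, with success probability $p$. Count success runs of length $k$ with overlap at most $\ell$: the first counted run ends at the first trial $T_1$ such that the last $k$ trials up to and including it are successes, and $T_{c+1}$ is the first $n\ge T_c+k-\ell$ such that trials $n-k+1,\dots,n$ are all successes. Let $Y=T_r\sim\mathrm{NB}(k,r,\ell)$, $f_{r,k,\ell}(n)=\mathbb P(Y=n)$, and let $f_k(n)=\mathbb P(T_1=n)$ be the probability mass function of the geometric distribution of order $k$. Let $\lambda_0,\dots,\lambda_{k-1}$ be the complex roots, listed with multiplicity, of the auxiliary polynomial $z^k-qz^{k-1}-qpz^{k-2}-\dots-qp^{k-1}$. Then the $\lambda_j$ are distinct, nonzero and satisfy $|\lambda_j|<1$; $Y$ is almost surely finite and all its factorial moments $\mathscr M_{(i)}=\mathbb E[Y(Y-1)\cdots(Y-i+1)]$ are finite. There are complex coefficients $a_{jm}$ ($0\le j\le k-1$, $1\le m\le r$) with $$f_{r,k,\ell}(n)=\sum_{j=0}^{k-1}\sum_{m=1}^{r}\binom{n-1}{m-1}a_{jm}\lambda_j^{\,n-m}\qquad(n\ge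 1),$$ and for any such coefficients and every integer $i\ge1$, $$\mathscr M_{(i)}=\frac{i!}{(qp^k)^i}\sum_{j=0}^{k-1}\sum_{m=1}^{r}a_{jm}\frac{\lambda_j^{(i+m)k+i}}{(qp^k)^m}\sum_{b=1}^{m}\binom mb\binom{i-1}{b-1}\lambda_j^{-b} =\frac{i!}{(qp^k)^i}\sum_{j=0}^{k-1}\sum_{m=1}^{r}a_{jm}\frac{m\,\lambda_j^{(i+m)k+i-1}}{(qp^k)^m}\;{}_2F_1\!\left(1-m,1-i;2;\tfrac1{\lambda_j}\right).$$ For $\ell=k-1$, $Y$ is the waiting time of Type III, i.e. the least $n$ such that at least $r$ of the blocks of $k$ consecutive trials among the first $n$ trials consist of successes only. For $r=1$ and every $i\ge 1$, $$\mathscr M_{(i)}=\frac{i!}{(qp^k)^{i+1}}\,f_k\big((i+1)k+i\big).$$ -/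

import Mathlib

open MeasureTheory ProbabilityTheory

/-- For a sequence `x` of trial outcomes (`true` is success, `x t` is the outcome of trial number
`t + 1`): at least `k` trials have been made after trial number `n`, and the last `k` of the first
`n` trials are all successes. -/
def RunEndsAt (k : ℕ) (x : ℕ → Bool) (n : ℕ) : Prop :=
  k ≤ n ∧ ∀ t, n - k ≤ t → t < n → x t = true

/-- The number of trials needed for the first run of `k` consecutive successes
(`⊤` if there is none). -/
noncomputable def firstRunTime (k : ℕ) (x : ℕ → Bool) : ℕ∞ :=
  ⨅ (n : ℕ) (_ : RunEndsAt k x n), (n : ℕ∞)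

/-- The number of trials needed to count `r` success runs of length `k` (`⊤` if this never happens),
when consecutively counted runs may share at most `ℓ < k` trials. The first counted run is the first
one to be completed; after a counted run that ends at trial `T`, the next counted run is the first
one to be completed at a trial `n ≥ T + (k - ℓ)`. For the first run the constraint
`0 + (k - ℓ) ≤ n` is void, because `k ≤ n`. -/
noncomputable def overlapRunTime (k ℓ : ℕ) (x : ℕ → Bool) : ℕ → ℕ∞
  | 0 => 0
  | r + 1 => ⨅ (n : ℕ) (_ : RunEndsAt k x n ∧ overlapRunTime k ℓ x r + ((k - ℓ : ℕ) : ℕ∞) ≤ n),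
      (n : ℕ∞)

/-- The Type III waiting time: the least number `n` of trials such that at least `r` of the blocks of
`k` consecutive trials among the first `n` trials consist of successes only. -/
noncomputable def typeIIIRunTime (k : ℕ) (x : ℕ → Bool) (r : ℕ) : ℕ∞ :=
  ⨅ (n : ℕ) (_ : r ≤ {m : ℕ | m ≤ n ∧ RunEndsAt k x m}.ncard), (n : ℕ∞)

/-- The random variable `NB(k, r, ℓ)` attached to a sequence of random trials `X`. -/
noncomputable def nbTime {Ω : Type*} (X : ℕ → Ω → Bool) (k r ℓ : ℕ) (ω : Ω) : ℕ∞ :=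
  overlapRunTime k ℓ (fun t => X t ω) r

/-- The probability mass function of `NB(k, r, ℓ)`. -/
noncomputable def nbPMF {Ω : Type*} [MeasurableSpace Ω] (P : Measure Ω) (X : ℕ → Ω → Bool)
    (k r ℓ n : ℕ) : ℝ :=
  P.real {ω | nbTime X k r ℓ ω = (n : ℕ∞)}

/-- The probability mass function of the geometric distribution of order `k`. -/
noncomputable def geomPMF {Ω : Type*} [MeasurableSpace Ω] (P : Measure Ω) (X : ℕ → Ω → Bool)
    (k n : ℕ) : ℝ :=
  P.real {ω | firstRunTime k (fun t => X t ω) = (n : ℕ∞)}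

/-- The falling factorial `Y (Y - 1) ⋯ (Y - i + 1)` of `Y = NB(k, r, ℓ)`
(with `Y` read as `0` where it is infinite). -/
noncomputable def nbFalling {Ω : Type*} (X : ℕ → Ω → Bool) (k r ℓ i : ℕ) (ω : Ω) : ℝ :=
  ((nbTime X k r ℓ ω).toNat.descFactorial i : ℝ)

/-- The `i`-th factorial moment of `NB(k, r, ℓ)`. -/
noncomputable def nbFactorialMoment {Ω : Type*} [MeasurableSpace Ω] (P : Measure Ω)
    (X : ℕ → Ω → Bool) (k r ℓ i : ℕ) : ℝ :=
  ∫ ω, nbFalling X k r ℓ i ω ∂P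

/-- The auxiliary polynomial `z ^ k - q z ^ (k - 1) - q p z ^ (k - 2) - ⋯ - q p ^ (k - 1)`,
with `q = 1 - p`. -/
noncomputable def auxPoly (k : ℕ) (p : ℝ) : Polynomial ℂ :=
  Polynomial.X ^ k - ∑ j ∈ Finset.range k,
    Polynomial.C (((1 - p) * p ^ j : ℝ) : ℂ) * Polynomial.X ^ (k - 1 - j)

/-- The numbers `a j m` (`1 ≤ m ≤ r`) are coefficients of the expansion of a probability mass
function `f` in powers of the `lam j`:
`f n = ∑ j, ∑ m, (n - 1).choose (m - 1) * a j m * lam j ^ (n - m)` for all `n ≥ 1`.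
The terms with `m > n` vanish because of the binomial coefficient. -/
def IsRootExpansion {k : ℕ} (r : ℕ) (lam : Fin k → ℂ) (f : ℕ → ℝ) (a : Fin k → ℕ → ℂ) : Prop :=
  ∀ n : ℕ, 1 ≤ n → (f n : ℂ) =
    ∑ j : Fin k, ∑ m ∈ Finset.Icc 1 r,
      ((n - 1).choose (m - 1) : ℂ) * a j m * lam j ^ (n - m)

/-! The counting is a Markov chain on the number s < k of successes available for the next run: a
failure resets s to 0, and completing a run resets it to ℓ. Let f_{s,r} be the mass function of the
remaining time from state s with r runs to count, E the shift, and A_s = `auxPoly s p`. Conditioning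
on one trial gives E f_{s,r} = p f_{s+1,r} + q f_{0,r}, hence p^s f_{s,r} = A_s(E) f_{0,r}; at s = k
the left side becomes p^k f_{ℓ,r-1} (`pow_smul_hitProb`). Iterating over r, A_k(E)^r annihilates n ↦
f_{0,r}(n + 1).

The roots of A_k are simple, so the kernel of A_k(E)^r splits over the distinct roots, and each
summand consists of binomials times powers. This is the root expansion.

The roots have modulus less than 1, so the moments can be summed termwise; Nanjundiah's identity
reduces each series to negative binomial ones and produces powers of 1/(1 - λ). Since (X - p) A_k =
X^(k+1) - X^k + q p^k, a root satisfies 1 - λ = q p^k / λ^k, which turns these into powers of λ. For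
r = 1 the resulting sum is again the root expansion, evaluated at a single n. -/

/-! ### Factorial moments of binomials times powers -/

/-- The product `x.choose (s + 1) * (x - 1).choose n` in terms of single binomial coefficients
(a case of Nanjundiah's identity). -/
theorem sum_choose_mul_choose_mul_choose_add (x s n : ℕ) :
    ∑ c ∈ Finset.range (n + 1), s.choose c * (n + 1).choose (n - c) *
      (x + c).choose (s + 1 + n) = x.choose (s + 1) * (x - 1).choose n := by
  have expand : ∀ c ∈ Finset.range (n + 1), (x + c).choose (s + 1 + n) =
      ∑ j ∈ Finset.range (n + 1), c.choose j * x.choose (s + 1 + n - j) := by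
    intro c hc
    rw [add_comm, Nat.add_choose_eq, Finset.Nat.sum_antidiagonal_eq_sum_range_succ_mk]
    symm
    apply Finset.sum_subset
    · intro j hj
      simp only [Finset.mem_range] at *
      omega
    · intro j _ hj
      simp only [Finset.mem_range] at *
      rw [Nat.choose_eq_zero_of_lt (by omega), zero_mul]
  have inner : ∀ j ∈ Finset.range (n + 1),
      ∑ c ∈ Finset.range (n + 1), s.choose c * (n + 1).choose (n - c) * c.choose j =
        s.choose j * (s - j + (n + 1)).choose (n - j) := by
    intro j hj
    rw [Finset.mem_range] at hj
    rw [Nat.add_choose_eq, Finset.Nat.sum_antidiagonal_eq_sum_range_succ_mk, Finset.mul_sum]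
    have hsplit : n + 1 = j + (n - j + 1) := by omega
    conv_lhs => rw [hsplit, Finset.sum_range_add]
    rw [Finset.sum_eq_zero, zero_add]
    · apply Finset.sum_congr rfl
      intro t _
      have h1 : s.choose (j + t) * (j + t).choose j = s.choose j * (s - j).choose t := by
        rw [Nat.choose_mul (by omega), Nat.add_sub_cancel_left]
      rw [← hsplit, Nat.sub_add_eq]
      rw [mul_right_comm, h1, mul_assoc]
    · intro c hc
      rw [Finset.mem_range] at hc
      rw [Nat.choose_eq_zero_of_lt hc, mul_zero]
  -- Exchange the sums; Vandermonde evaluates the sum over c, trinomial revision extracts `x.choose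
  -- (s + 1)`, and a last Vandermonde sums over j.
  calc _ = ∑ j ∈ Finset.range (n + 1), x.choose (s + 1 + n - j) *
        ∑ c ∈ Finset.range (n + 1), s.choose c * (n + 1).choose (n - c) * c.choose j := by
        rw [Finset.sum_congr rfl fun c hc => by rw [expand c hc, Finset.mul_sum], Finset.sum_comm]
        refine Finset.sum_congr rfl fun j _ => ?_
        rw [Finset.mul_sum]
        exact Finset.sum_congr rfl fun c _ => by ring
    _ = ∑ j ∈ Finset.range (n + 1), x.choose (s + 1) *
          (s.choose j * (x - (s + 1)).choose (n - j)) := by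
        refine Finset.sum_congr rfl fun j hj => ?_
        rw [inner j hj]
        rw [Finset.mem_range] at hj
        rcases lt_or_ge s j with h | h
        · simp [Nat.choose_eq_zero_of_lt h]
        · have h1 : s - j + (n + 1) = s + 1 + n - j := by omega
          have h2 := Nat.choose_mul (n := x) (k := s + 1 + n - j) (s := s + 1) (by omega)
          have h3 : (s + 1 + n - j).choose (n - j) = (s + 1 + n - j).choose (s + 1) := by
            rw [← Nat.choose_symm (by omega)]
            congr 1
            omega
          have h4 : s + 1 + n - j - (s + 1) = n - j := by omega
          rw [h4] at h2
          rw [h1, h3, mul_left_comm, h2]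
          ring
    _ = _ := by
        rw [← Finset.mul_sum]
        rcases lt_or_ge x (s + 1) with h | h
        · simp [Nat.choose_eq_zero_of_lt h]
        · have h1 : x - 1 = s + (x - (s + 1)) := by omega
          rw [h1, Nat.add_choose_eq, Finset.Nat.sum_antidiagonal_eq_sum_range_succ_mk]

/-- The negative binomial series, reindexed by n = t + (s + m - c). The terms with smaller n have a
vanishing binomial, so the truncation in `n - m` is harmless; c ≤ s makes the exponent t + (s - c).
-/
theorem hasSum_choose_add_mul_pow {x : ℂ} (hx : ‖x‖ < 1) {s m c : ℕ} (hcs : c ≤ s) :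
    HasSum (fun n : ℕ => ((n + 1 + c).choose (s + 1 + m) : ℂ) * x ^ (n - m))
      (x ^ (s - c) / (1 - x) ^ (s + 1 + m + 1)) := by
  have h := (hasSum_choose_mul_geometric_of_norm_lt_one (s + 1 + m) hx).mul_right (x ^ (s - c))
  have hinj : Function.Injective fun t : ℕ => t + (s + m - c) := add_left_injective _
  rw [one_div, inv_mul_eq_div] at h
  rw [← hinj.hasSum_iff]
  · refine (congrArg (HasSum · _) (funext fun t => ?_)).mpr h
    have h1 : t + (s + m - c) + 1 + c = t + (s + 1 + m) := by omega
    have h2 : t + (s + m - c) - m = t + (s - c) := by omega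
    simp only [Function.comp, h1, h2, pow_add, mul_assoc]
  · intro n hn
    rw [Nat.choose_eq_zero_of_lt, Nat.cast_zero, zero_mul]
    by_contra hlt
    exact hn ⟨n - (s + m - c), by simp only; omega⟩

theorem sum_Icc_one_eq_sum_range {M : Type*} [AddCommMonoid M] (f : ℕ → M) (m : ℕ) :
    ∑ b ∈ Finset.Icc 1 m, f b = ∑ c ∈ Finset.range m, f (c + 1) := by
  rw [Finset.sum_bij (fun b _ => b - 1) (t := Finset.range m) (g := fun c => f (c + 1))]
  · intro b hb
    simp only [Finset.mem_Icc, Finset.mem_range] at *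
    omega
  · intro b hb b' hb' h
    simp only [Finset.mem_Icc] at *
    omega
  · intro c hc
    rw [Finset.mem_range] at hc
    exact ⟨c + 1, by simp; omega, by simp⟩
  · intro b hb
    rw [Finset.mem_Icc] at hb
    congr 1
    omega

/-- The descending factorial moments of the sequence `n ↦ (n - 1).choose (m - 1) * x ^ (n - m)`. -/
theorem hasSum_descFactorial_mul_choose_mul_pow {x : ℂ} (hx : ‖x‖ < 1) (hx0 : x ≠ 0) {i m : ℕ}
    (hi : 1 ≤ i) (hm : 1 ≤ m) :
    HasSum (fun n : ℕ => (n.descFactorial i : ℂ) * (((n - 1).choose (m - 1) : ℂ) * x ^ (n - m)))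
      (i.factorial * (x ^ i / (1 - x) ^ (i + m) * ∑ b ∈ Finset.Icc 1 m,
        (m.choose b : ℂ) * ((i - 1).choose (b - 1) : ℂ) * (x ^ b)⁻¹)) := by
  obtain ⟨s, rfl⟩ := Nat.exists_eq_add_of_le' hi
  obtain ⟨m, rfl⟩ := Nat.exists_eq_add_of_le' hm
  rw [← hasSum_nat_add_iff' 1]
  simp only [Finset.range_one, Finset.sum_singleton, Nat.zero_descFactorial_succ, Nat.cast_zero,
    zero_mul, sub_zero, Nat.add_sub_cancel, Nat.add_sub_add_right]
  rw [sum_Icc_one_eq_sum_range]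
  -- Nanjundiah's identity replaces the product of two binomials in n by a combination of single
  -- ones, each of which has a known series.
  have key : ∀ n : ℕ, ((n + 1).descFactorial (s + 1) : ℂ) * ((n.choose m : ℂ) * x ^ (n - m)) =
      (s + 1).factorial * ∑ c ∈ Finset.range (m + 1), ((s.choose c : ℂ) * (m + 1).choose (m - c)) *
        (((n + 1 + c).choose (s + 1 + m) : ℂ) * x ^ (n - m)) := by
    intro n
    have h := congrArg (Nat.cast : ℕ → ℂ) (sum_choose_mul_choose_mul_choose_add (n + 1) s m)
    push_cast [Nat.add_sub_cancel] at h
    simp only [← mul_assoc] at h ⊢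
    rw [← Finset.sum_mul, h, Nat.descFactorial_eq_factorial_mul_choose]
    push_cast
    ring
  simp only [key]
  apply HasSum.mul_left
  rw [Finset.mul_sum]
  apply hasSum_sum
  intro c hc
  rw [Finset.mem_range] at hc
  rcases lt_or_ge s c with h | h
  · simp [Nat.choose_eq_zero_of_lt h]
  · have h1 := (hasSum_choose_add_mul_pow hx (m := m) h).mul_left
      ((s.choose c : ℂ) * (m + 1).choose (m - c))
    convert h1 using 1
    have h2 : (m + 1).choose (m - c) = (m + 1).choose (c + 1) := by
      rw [← Nat.choose_symm (by omega)]
      congr 1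
      omega
    have h3 : x ^ (s + 1) = x ^ (s - c) * x ^ (c + 1) := by
      rw [← pow_add]
      congr 1
      omega
    have h4 : x ^ (c + 1) ≠ 0 := pow_ne_zero _ hx0
    rw [h2, h3, Nat.add_sub_cancel, show s + 1 + (m + 1) = s + 1 + m + 1 by ring]
    field_simp

/-! ### The inner sum as a hypergeometric value -/

theorem ascPochhammer_eval_neg_natCast (M n : ℕ) :
    (ascPochhammer ℂ n).eval (-M : ℂ) = (-1) ^ n * n.factorial * M.choose n := by
  induction n with
  | zero => simp
  | succ n ih =>
    rw [ascPochhammer_succ_eval, ih, Nat.factorial_succ, pow_succ]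
    have h := congrArg (Nat.cast : ℕ → ℂ) (Nat.choose_succ_right_eq M n)
    rcases le_or_gt n M with hn | hn
    · push_cast [hn] at h ⊢
      linear_combination (-1 : ℂ) ^ n * n.factorial * h
    · simp [Nat.choose_eq_zero_of_lt hn, Nat.choose_eq_zero_of_lt (Nat.lt_succ_of_lt hn)]

theorem ascPochhammer_eval_two (n : ℕ) :
    (ascPochhammer ℂ n).eval (2 : ℂ) = (n + 1).factorial := by
  induction n with
  | zero => simp
  | succ n ih =>
    rw [ascPochhammer_succ_eval, ih, Nat.factorial_succ (n + 1)]
    push_cast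
    ring

/-- The series terminates because 1 - m is a nonpositive integer. The signs of the two upper
Pochhammer symbols cancel, and with b = c + 1 the factor m/(c + 1) turns (m - 1 choose c) into (m
choose b). -/
theorem natCast_mul_ordinaryHypergeometric {x : ℂ} {i m : ℕ} (hi : 1 ≤ i) (hm : 1 ≤ m) :
    (m : ℂ) * x⁻¹ * ordinaryHypergeometric (1 - m : ℂ) (1 - i : ℂ) (2 : ℂ) (1 / x) =
      ∑ b ∈ Finset.Icc 1 m, (m.choose b : ℂ) * ((i - 1).choose (b - 1) : ℂ) * (x ^ b)⁻¹ := by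
  obtain ⟨s, rfl⟩ := Nat.exists_eq_add_of_le' hi
  obtain ⟨m, rfl⟩ := Nat.exists_eq_add_of_le' hm
  have h1 : (1 - ((m + 1 : ℕ) : ℂ)) = -(m : ℂ) := by push_cast; ring
  have h2 : (1 - ((s + 1 : ℕ) : ℂ)) = -(s : ℂ) := by push_cast; ring
  rw [ordinaryHypergeometric_eq_tsum, h1, h2, sum_Icc_one_eq_sum_range]
  simp only [ascPochhammer_eval_neg_natCast, ascPochhammer_eval_two]
  rw [tsum_eq_sum (s := Finset.range (m + 1))]
  · rw [Finset.mul_sum]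
    refine Finset.sum_congr rfl fun c _ => ?_
    have h3 := congrArg (Nat.cast : ℕ → ℂ) (Nat.add_one_mul_choose_eq m c)
    have h4 : (c.factorial : ℂ) ≠ 0 := Nat.cast_ne_zero.2 (Nat.factorial_ne_zero c)
    have h5 : (c : ℂ) + 1 ≠ 0 := Nat.cast_add_one_ne_zero c
    have h6 : ((-1 : ℂ) ^ c) * (-1) ^ c = 1 := by rw [← mul_pow]; simp
    push_cast [Nat.factorial_succ] at h3 ⊢
    rw [one_div, inv_pow, pow_succ, smul_eq_mul]
    have h7 : ((c.factorial : ℂ)⁻¹ * ((-1) ^ c * c.factorial * m.choose c) *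
        ((-1) ^ c * c.factorial * s.choose c) * (((c : ℂ) + 1) * c.factorial)⁻¹) =
        m.choose c * s.choose c / (c + 1) := by
      field_simp
      linear_combination ((m.choose c : ℂ) * s.choose c) * h6
    rw [h7]
    have h8 : ((m + 1).choose (c + 1) : ℂ) = (m + 1) * m.choose c / (c + 1) := by
      field_simp
      linear_combination -h3
    rw [h8]
    ring
  · intro c hc
    rw [Finset.mem_range, not_lt] at hc
    simp [Nat.choose_eq_zero_of_lt (show m < c by omega)]

/-! ### Roots of the auxiliary polynomial -/

open Polynomial in
theorem X_sub_C_mul_auxPoly (k : ℕ) (p : ℝ) :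
    (X - C (p : ℂ)) * auxPoly k p = X ^ (k + 1) - X ^ k + C ((1 - p : ℂ) * (p : ℂ) ^ k) := by
  have h := (Commute.all (C (p : ℂ)) X).mul_geom_sum₂ k
  have h2 : ∑ j ∈ Finset.range k, C (((1 - p) * p ^ j : ℝ) : ℂ) * X ^ (k - 1 - j) =
      C (1 - p : ℂ) * ∑ j ∈ Finset.range k, C (p : ℂ) ^ j * X ^ (k - 1 - j) := by
    rw [Finset.mul_sum]
    refine Finset.sum_congr rfl fun j _ => ?_
    push_cast
    simp [mul_assoc]
  rw [auxPoly, h2]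
  simp only [C_mul, C_pow, C_sub, C_1] at h ⊢
  linear_combination (1 - C (p : ℂ)) * h

theorem auxPoly_isRoot_iff {k : ℕ} {p : ℝ} {z : ℂ} : (auxPoly k p).IsRoot z ↔
    z ^ k = ∑ j ∈ Finset.range k, (((1 - p) * p ^ j : ℝ) : ℂ) * z ^ (k - 1 - j) := by
  rw [Polynomial.IsRoot, auxPoly, Polynomial.eval_sub, Polynomial.eval_finsetSum, sub_eq_zero]
  simp

/-- A root `z` of the auxiliary polynomial satisfies `z ^ k * (1 - z) = q p ^ k`. -/
theorem pow_mul_one_sub_of_isRoot {k : ℕ} {p : ℝ} {z : ℂ} (h : (auxPoly k p).IsRoot z) :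
    z ^ k * (1 - z) = (1 - p : ℂ) * (p : ℂ) ^ k := by
  have h1 := congrArg (Polynomial.eval z) (X_sub_C_mul_auxPoly k p)
  rw [Polynomial.eval_mul, h.eq_zero] at h1
  simp at h1
  linear_combination h1

theorem sum_range_one_sub_mul_pow (n : ℕ) (p : ℝ) :
    ∑ j ∈ Finset.range n, (1 - p) * p ^ j = 1 - p ^ n := by
  rw [← Finset.mul_sum, mul_neg_geom_sum]

/-- The subtracted coefficients are nonnegative with sum 1 - p^k < 1, so for |z| ≥ 1 the leading
term dominates. -/
theorem norm_lt_one_of_auxPoly_isRoot {k : ℕ} {p : ℝ} (hp0 : 0 < p) (hp1 : p < 1)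
    {z : ℂ} (h : (auxPoly k p).IsRoot z) : ‖z‖ < 1 := by
  by_contra! hz
  rw [auxPoly_isRoot_iff] at h
  have hpos : 0 < ‖z‖ ^ (k - 1) := by positivity
  have h1 : ‖z‖ ^ k ≤ (1 - p ^ k) * ‖z‖ ^ (k - 1) := by
    rw [← norm_pow, h, ← sum_range_one_sub_mul_pow, Finset.sum_mul]
    refine norm_sum_le_of_le _ fun j _ => ?_
    have h2 : 0 ≤ (1 - p) * p ^ j := mul_nonneg (by linarith) (by positivity)
    rw [norm_mul, Complex.norm_real, Real.norm_of_nonneg h2, norm_pow]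
    exact mul_le_mul_of_nonneg_left (pow_le_pow_right₀ hz (Nat.sub_le _ _)) h2
  have h3 : ‖z‖ ^ (k - 1) ≤ ‖z‖ ^ k := pow_le_pow_right₀ hz (Nat.sub_le _ _)
  have h4 : 0 < p ^ k := by positivity
  nlinarith

theorem ne_zero_of_auxPoly_isRoot {k : ℕ} {p : ℝ} (hp0 : 0 < p) (hp1 : p < 1) (hk : 0 < k)
    {z : ℂ} (h : (auxPoly k p).IsRoot z) : z ≠ 0 := by
  rintro rfl
  have h1 := pow_mul_one_sub_of_isRoot h
  rw [zero_pow hk.ne', zero_mul] at h1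
  have h2 : (1 - p) * p ^ k ≠ 0 := mul_ne_zero (by linarith) (by positivity)
  exact h2 (by exact_mod_cast h1.symm)

/-- `z A'(z) - k A(z)` for the auxiliary polynomial `A`. -/
theorem mul_eval_derivative_auxPoly (k : ℕ) (p : ℝ) (z : ℂ) :
    z * (auxPoly k p).derivative.eval z - k * (auxPoly k p).eval z =
      ∑ j ∈ Finset.range k, (((1 - p) * p ^ j : ℝ) : ℂ) * (j + 1) * z ^ (k - 1 - j) := by
  have hpow : ∀ n : ℕ, z * (n * z ^ (n - 1)) = n * z ^ n := by
    rintro (_ | n)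
    · simp
    · rw [Nat.add_sub_cancel, pow_succ]
      ring
  simp only [auxPoly, Polynomial.derivative_sub, Polynomial.derivative_sum,
    Polynomial.derivative_C_mul, Polynomial.derivative_X_pow, Polynomial.eval_sub,
    Polynomial.eval_finsetSum, Polynomial.eval_mul, Polynomial.eval_C, Polynomial.eval_pow,
    Polynomial.eval_X, mul_sub, Finset.mul_sum, hpow]
  rw [sub_sub_sub_cancel_left, ← Finset.sum_sub_distrib]
  refine Finset.sum_congr rfl fun j hj => ?_
  rw [Finset.mem_range] at hj
  rw [mul_left_comm z, hpow, show k - 1 - j = k - (j + 1) by omega, Nat.cast_sub (by omega)]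
  push_cast
  ring

/-- A double root of A is a double root of (X - p) A, whose derivative is X^(k-1) ((k + 1) X - k);
being nonzero it must be k/(k + 1). But at a positive real z, z A'(z) - k A(z) is a sum of positive
terms. -/
theorem derivative_auxPoly_ne_zero_of_isRoot {k : ℕ} {p : ℝ} (hp0 : 0 < p) (hp1 : p < 1)
    (hk : 0 < k) {z : ℂ} (h : (auxPoly k p).IsRoot z) :
    (auxPoly k p).derivative.eval z ≠ 0 := by
  intro hd
  have hz0 := ne_zero_of_auxPoly_isRoot hp0 hp1 hk h
  have h1 := congrArg (fun P => Polynomial.eval z (Polynomial.derivative P))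
    (X_sub_C_mul_auxPoly k p)
  simp only [Polynomial.derivative_mul, Polynomial.eval_add, Polynomial.eval_mul, hd,
    h.eq_zero, mul_zero, add_zero, Polynomial.derivative_sub, Polynomial.derivative_X_pow, Polynomial.derivative_add,
    Polynomial.derivative_C, Polynomial.eval_sub, Polynomial.eval_pow, Polynomial.eval_X,
    Polynomial.eval_C, Polynomial.eval_zero, Nat.add_sub_cancel] at h1
  obtain ⟨k, rfl⟩ := Nat.exists_eq_add_of_le' hk
  rw [Nat.add_sub_cancel, pow_succ] at h1
  have h2 : z ^ k * ((k + 2) * z - (k + 1)) = 0 := by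
    push_cast at h1
    linear_combination -h1
  have h3 := (mul_eq_zero.1 h2).resolve_left (pow_ne_zero _ hz0)
  have hk2 : (k : ℂ) + 2 ≠ 0 := by exact_mod_cast (show k + 2 ≠ 0 by omega)
  have h4 : z = ((((k : ℝ) + 1) / (k + 2) : ℝ) : ℂ) := by
    push_cast
    field_simp
    linear_combination h3
  set x : ℝ := ((k : ℝ) + 1) / (k + 2) with hx
  have hx0 : 0 < x := by positivity
  have h5 := mul_eval_derivative_auxPoly (k + 1) p z
  rw [hd, h.eq_zero, h4] at h5
  have h6 : 0 < ∑ j ∈ Finset.range (k + 1),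
      ((1 - p) * p ^ j) * ((j : ℝ) + 1) * x ^ (k + 1 - 1 - j) := by
    refine Finset.sum_pos (fun j _ => ?_) ⟨0, by simp⟩
    have : 0 < 1 - p := by linarith
    positivity
  refine h6.ne ?_
  rw [mul_zero, mul_zero, sub_zero] at h5
  exact_mod_cast h5

theorem auxPoly_isRoot_of_eq_prod {k : ℕ} {p : ℝ} {lam : Fin k → ℂ}
    (hlam : auxPoly k p = ∏ j : Fin k, (Polynomial.X - Polynomial.C (lam j))) (j : Fin k) :
    (auxPoly k p).IsRoot (lam j) := by
  rw [hlam, Polynomial.IsRoot, Polynomial.eval_prod]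
  exact Finset.prod_eq_zero (Finset.mem_univ j) (by simp)

theorem injective_of_auxPoly_eq_prod {k : ℕ} {p : ℝ} {lam : Fin k → ℂ}
    (hlam : auxPoly k p = ∏ j : Fin k, (Polynomial.X - Polynomial.C (lam j)))
    (hp0 : 0 < p) (hp1 : p < 1) : Function.Injective lam := by
  intro a b hab
  by_contra hne
  have hroot := auxPoly_isRoot_of_eq_prod hlam a
  refine derivative_auxPoly_ne_zero_of_isRoot hp0 hp1 (Nat.pos_of_ne_zero ?_) hroot ?_
  · rintro rfl
    exact a.elim0
  · have h : auxPoly k p = (Polynomial.X - Polynomial.C (lam a)) *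
        ((Polynomial.X - Polynomial.C (lam b)) * ∏ j ∈ (Finset.univ.erase a).erase b,
          (Polynomial.X - Polynomial.C (lam j))) := by
      rw [hlam, Finset.mul_prod_erase _ (fun j => Polynomial.X - Polynomial.C (lam j))
        (by simp [Ne.symm hne]), Finset.mul_prod_erase _
        (fun j => Polynomial.X - Polynomial.C (lam j)) (Finset.mem_univ a)]
    rw [h]
    simp [hab]

/-! ### Solutions of linear recurrences -/

/-- The shift operator on sequences. -/
def seqShift : Module.End ℂ (ℕ → ℂ) where
  toFun s n := s (n + 1)
  map_add' _ _ := rfl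
  map_smul' _ _ := rfl

open Polynomial in
theorem exists_eq_sum_of_aeval_X_sub_C_pow_eq_zero (x : ℂ) (r : ℕ) (s : ℕ → ℂ)
    (hs : aeval seqShift ((X - C x) ^ r) s = 0) :
    ∃ a : ℕ → ℂ, ∀ n, s n =
      ∑ m ∈ Finset.Icc 1 r, (n.choose (m - 1) : ℂ) * a m * x ^ (n + 1 - m) := by
  simp only [sum_Icc_one_eq_sum_range, Nat.add_sub_cancel, Nat.add_sub_add_right]
  induction r generalizing s with
  | zero => exact ⟨0, fun n => by simpa using congrFun hs n⟩
  | succ r ih =>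
    rw [pow_succ, map_mul, Module.End.mul_apply] at hs
    obtain ⟨a, ha⟩ := ih _ hs
    have hstep : ∀ n, s (n + 1) = x * s n +
        ∑ c ∈ Finset.range r, (n.choose c : ℂ) * a (c + 1) * x ^ (n - c) := by
      intro n
      rw [← ha]
      simp [seqShift]
    -- By Pascal's rule E - x sends (n choose c+1) x^(n-c-1) to (n choose c) x^(n-c), so the
    -- coefficients move up one place; the new constant is the initial value.
    refine ⟨fun m => if m = 1 then s 0 else a (m - 1), fun n => ?_⟩
    rw [Finset.sum_range_succ']
    simp only [Nat.add_sub_cancel]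
    induction n with
    | zero => simp
    | succ n ihn =>
      rw [hstep, ihn, mul_add, Finset.mul_sum, add_right_comm, ← Finset.sum_add_distrib]
      congr 1
      · refine Finset.sum_congr rfl fun c _ => ?_
        simp only [Nat.add_sub_add_right, Nat.choose_succ_succ]
        rcases lt_or_ge n (c + 1) with h | h
        · simp [Nat.choose_eq_zero_of_lt h]
        · rw [show n - c = n - (c + 1) + 1 by omega]
          push_cast
          ring
      · simp only [Nat.choose_zero_right, Nat.sub_zero]
        push_cast
        ring

-- Primary decomposition: the factors are coprime as the roots are distinct, so the kernel of the
-- product is the sum of the kernels.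
open Polynomial in
theorem exists_eq_sum_of_aeval_prod_eq_zero {ι : Type*} [DecidableEq ι] (S : Finset ι)
    {lam : ι → ℂ} (hinj : Function.Injective lam) (r : ℕ) (s : ℕ → ℂ)
    (hs : aeval seqShift (∏ j ∈ S, (X - C (lam j)) ^ r) s = 0) :
    ∃ a : ι → ℕ → ℂ, ∀ n, s n = ∑ j ∈ S, ∑ m ∈ Finset.Icc 1 r,
      (n.choose (m - 1) : ℂ) * a j m * lam j ^ (n + 1 - m) := by
  induction S using Finset.induction_on generalizing s with
  | empty => exact ⟨0, fun n => by simpa using congrFun hs n⟩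
  | insert i S hi ih =>
    rw [Finset.prod_insert hi] at hs
    have hcop : IsCoprime ((X - C (lam i)) ^ r) (∏ j ∈ S, (X - C (lam j)) ^ r) := by
      refine IsCoprime.prod_right fun j hj => IsCoprime.pow ?_
      refine isCoprime_X_sub_C_of_isUnit_sub ?_
      rw [isUnit_iff_ne_zero, sub_ne_zero]
      exact fun h => hi (hinj h ▸ hj)
    have hmem : s ∈ LinearMap.ker (aeval seqShift ((X - C (lam i)) ^ r *
      ∏ j ∈ S, (X - C (lam j)) ^ r)) := hs
    rw [← sup_ker_aeval_eq_ker_aeval_mul_of_coprime _ hcop, Submodule.mem_sup] at hmem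
    obtain ⟨u, hu, v, hv, rfl⟩ := hmem
    obtain ⟨a, ha⟩ := exists_eq_sum_of_aeval_X_sub_C_pow_eq_zero (lam i) r u hu
    obtain ⟨b, hb⟩ := ih v hv
    refine ⟨Function.update b i a, fun n => ?_⟩
    rw [Finset.sum_insert hi, Pi.add_apply, ha, hb, Function.update_self]
    congr 1
    refine Finset.sum_congr rfl fun j hj => ?_
    rw [Function.update_of_ne]
    rintro rfl
    exact hi hj

/-! ### Waiting times as least times -/

section LeastTime

/-- The least natural number with the property `Q`, or `⊤`. -/
noncomputable def leastTime (Q : ℕ → Prop) : ℕ∞ := ⨅ (n : ℕ) (_ : Q n), (n : ℕ∞)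

theorem leastTime_le {Q : ℕ → Prop} {n : ℕ} (h : Q n) : leastTime Q ≤ n := iInf₂_le n h

theorem leastTime_spec {Q : ℕ → Prop} {n : ℕ} (h : leastTime Q = n) : Q n := by
  by_contra hn
  have h1 : ((n + 1 : ℕ) : ℕ∞) ≤ leastTime Q := by
    refine le_iInf₂ fun m hm => ?_
    have h2 : (n : ℕ∞) ≤ m := h ▸ leastTime_le hm
    have h3 : n ≤ m := by exact_mod_cast h2
    have h4 : n ≠ m := by
      rintro rfl
      exact hn hm
    exact_mod_cast Nat.lt_of_le_of_ne h3 h4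
  rw [h] at h1
  have h2 : n + 1 ≤ n := by exact_mod_cast h1
  omega

theorem leastTime_le_iff {Q : ℕ → Prop} {n : ℕ} : leastTime Q ≤ n ↔ ∃ m ≤ n, Q m := by
  constructor
  · intro h
    obtain ⟨m, hm⟩ := ENat.ne_top_iff_exists.1 (ne_top_of_le_ne_top (ENat.natCast_ne_top n) h)
    refine ⟨m, ?_, leastTime_spec hm.symm⟩
    rw [← hm] at h
    exact_mod_cast h
  · rintro ⟨m, hmn, hm⟩
    exact (leastTime_le hm).trans (by exact_mod_cast hmn)

theorem leastTime_eq_natCast_add {Q R : ℕ → Prop} {d : ℕ} (h : ∀ n, Q n ↔ d ≤ n ∧ R (n - d)) :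
    leastTime Q = d + leastTime R := by
  apply le_antisymm
  · rcases eq_or_ne (leastTime R) ⊤ with hR | hR
    · simp [hR]
    · obtain ⟨m, hm⟩ := ENat.ne_top_iff_exists.1 hR
      rw [← hm]
      have h1 : Q (d + m) := (h _).2 ⟨by omega, by simpa using leastTime_spec hm.symm⟩
      exact_mod_cast leastTime_le h1
  · refine le_iInf₂ fun n hn => ?_
    obtain ⟨h1, h2⟩ := (h n).1 hn
    calc (d : ℕ∞) + leastTime R ≤ d + (n - d : ℕ) := by gcongr; exact leastTime_le h2
      _ = n := by exact_mod_cast Nat.add_sub_cancel' h1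

end LeastTime

theorem ENat.natCast_add_right_inj (d : ℕ) (a b : ℕ∞) : (d : ℕ∞) + a = d + b ↔ a = b :=
  (ENat.add_right_injective_of_ne_top (ENat.natCast_ne_top d)).eq_iff

theorem ENat.eq_of_forall_le_natCast_iff {a b : ℕ∞} (h : ∀ n : ℕ, a ≤ n ↔ b ≤ n) : a = b := by
  apply le_antisymm
  · induction b with
    | top => exact le_top
    | coe n => exact (h n).2 le_rfl
  · induction a with
    | top => exact le_top
    | coe n => exact (h n).1 le_rfl

theorem overlapRunTime_succ (k ℓ : ℕ) (x : ℕ → Bool) (r : ℕ) :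
    overlapRunTime k ℓ x (r + 1) = leastTime fun n =>
      RunEndsAt k x n ∧ overlapRunTime k ℓ x r + ((k - ℓ : ℕ) : ℕ∞) ≤ n := rfl

theorem overlapRunTime_one (k ℓ : ℕ) (x : ℕ → Bool) :
    overlapRunTime k ℓ x 1 = leastTime (RunEndsAt k x) := by
  rw [overlapRunTime_succ]
  congr 1
  funext n
  rw [overlapRunTime, zero_add, eq_iff_iff, and_iff_left_iff_imp]
  rintro ⟨h, -⟩
  exact_mod_cast (Nat.sub_le k ℓ).trans h

theorem overlapRunTime_one_eq_firstRunTime (k ℓ : ℕ) (x : ℕ → Bool) :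
    overlapRunTime k ℓ x 1 = firstRunTime k x := overlapRunTime_one k ℓ x

theorem le_overlapRunTime_succ (k ℓ : ℕ) (x : ℕ → Bool) (r : ℕ) :
    (k : ℕ∞) ≤ overlapRunTime k ℓ x (r + 1) :=
  le_iInf₂ fun n hn => by exact_mod_cast hn.1.1

/-! ### Overlap k - 1 and the Type III waiting time -/

section TypeIII

theorem finite_setOf_le_and (n : ℕ) (Q : ℕ → Prop) : {m : ℕ | m ≤ n ∧ Q m}.Finite :=
  (Set.finite_Iic n).subset fun _ hm => hm.1

/-- For ℓ = k - 1 the required gap is a single trial, so every run end is counted. The induction on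
r removes the last run end up to n. -/
theorem overlapRunTime_pred_le_iff {k : ℕ} (hk : 0 < k) (x : ℕ → Bool) (r n : ℕ) :
    overlapRunTime k (k - 1) x r ≤ n ↔ r ≤ {m : ℕ | m ≤ n ∧ RunEndsAt k x m}.ncard := by
  induction r generalizing n with
  | zero => simp [overlapRunTime]
  | succ r ih =>
    have hshift : ∀ m : ℕ, RunEndsAt k x m →
        (overlapRunTime k (k - 1) x r + ((k - (k - 1) : ℕ) : ℕ∞) ≤ m ↔
          r ≤ {j : ℕ | j ≤ m - 1 ∧ RunEndsAt k x j}.ncard) := by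
      intro m hm
      have h1 : m = m - 1 + 1 := by have := hm.1; omega
      have h2 : (m : ℕ∞) = ((m - 1 : ℕ) : ℕ∞) + 1 := by exact_mod_cast h1
      rw [← ih, Nat.sub_sub_self hk, h2, Nat.cast_one, ENat.add_le_add_iff_right ENat.one_ne_top]
    have hcard : ∀ m : ℕ, RunEndsAt k x m → {j : ℕ | j ≤ m ∧ RunEndsAt k x j}.ncard =
        {j : ℕ | j ≤ m - 1 ∧ RunEndsAt k x j}.ncard + 1 := by
      intro m hm
      have h1 := hm.1
      rw [← Set.ncard_insert_of_notMem (a := m) (by simp; omega) (finite_setOf_le_and _ _)]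
      congr 1
      ext j
      simp only [Set.mem_ofPred_eq, Set.mem_insert_iff]
      constructor
      · rintro ⟨h2, h3⟩
        rcases eq_or_ne j m with h | h
        · exact Or.inl h
        · exact Or.inr ⟨by omega, h3⟩
      · rintro (rfl | ⟨h2, h3⟩)
        · exact ⟨le_rfl, hm⟩
        · exact ⟨by omega, h3⟩
    rw [overlapRunTime_succ, leastTime_le_iff]
    constructor
    · rintro ⟨m, hmn, hm, hle⟩
      rw [hshift m hm] at hle
      calc r + 1 ≤ {j : ℕ | j ≤ m ∧ RunEndsAt k x j}.ncard := by rw [hcard m hm]; omega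
        _ ≤ {j : ℕ | j ≤ n ∧ RunEndsAt k x j}.ncard :=
          Set.ncard_le_ncard (fun j hj => ⟨hj.1.trans hmn, hj.2⟩) (finite_setOf_le_and _ _)
    · intro h
      have hne : {m : ℕ | m ≤ n ∧ RunEndsAt k x m}.Nonempty :=
        Set.nonempty_of_ncard_ne_zero (by omega)
      obtain ⟨m, ⟨hmn, hm⟩, hmax⟩ := (finite_setOf_le_and n (RunEndsAt k x)).exists_maximal hne
      refine ⟨m, hmn, hm, ?_⟩
      rw [hshift m hm]
      have h1 : {m : ℕ | m ≤ n ∧ RunEndsAt k x m} = {j : ℕ | j ≤ m ∧ RunEndsAt k x j} := by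
        ext j
        simp only [Set.mem_ofPred_eq]
        constructor
        · intro hj
          refine ⟨?_, hj.2⟩
          by_contra hlt
          exact hlt (hmax hj (by omega))
        · exact fun hj => ⟨hj.1.trans hmn, hj.2⟩
      rw [h1, hcard m hm] at h
      omega

theorem overlapRunTime_pred_eq_typeIIIRunTime {k : ℕ} (hk : 0 < k) (x : ℕ → Bool) (r : ℕ) :
    overlapRunTime k (k - 1) x r = typeIIIRunTime k x r := by
  refine ENat.eq_of_forall_le_natCast_iff fun n => ?_
  rw [overlapRunTime_pred_le_iff hk]
  change _ ↔ leastTime _ ≤ _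
  rw [leastTime_le_iff]
  constructor
  · exact fun h => ⟨n, le_rfl, h⟩
  · rintro ⟨m, hmn, h⟩
    exact h.trans (Set.ncard_le_ncard (fun j hj => ⟨hj.1.trans hmn, hj.2⟩)
      (finite_setOf_le_and _ _))

end TypeIII

/-! ### Waiting times as a recursion on the first trial -/

section Automaton

/-- The sequence `x` preceded by `s` successes. -/
def prependSuccesses (s : ℕ) (x : ℕ → Bool) (t : ℕ) : Bool := if t < s then true else x (t - s)

/-- If `s` successes are available before the trials `x`, then exactly `n` trials are needed to count
`r` runs. -/
def HitsAt (k ℓ : ℕ) : ℕ → ℕ → ℕ → (ℕ → Bool) → Prop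
  | n, _, 0, _ => n = 0
  | 0, _, _ + 1, _ => False
  | n + 1, s, r + 1, x =>
    (x 0 = true ∧ (if s + 1 = k then HitsAt k ℓ n ℓ r fun t => x (t + 1)
      else HitsAt k ℓ n (s + 1) (r + 1) fun t => x (t + 1))) ∨
    (x 0 = false ∧ HitsAt k ℓ n 0 (r + 1) fun t => x (t + 1))

variable {k ℓ : ℕ}

theorem prependSuccesses_zero (x : ℕ → Bool) : prependSuccesses 0 x = x := by
  funext t
  simp [prependSuccesses]

theorem prependSuccesses_of_true {x : ℕ → Bool} (h : x 0 = true) (s : ℕ) :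
    prependSuccesses s x = prependSuccesses (s + 1) fun t => x (t + 1) := by
  funext t
  simp only [prependSuccesses]
  rcases lt_trichotomy t s with h1 | rfl | h1
  · simp [h1, Nat.lt_succ_of_lt h1]
  · simp [h]
  · rw [if_neg (by omega), if_neg (by omega)]
    congr 1
    omega

/-- A failure within the first `k` trials: counting starts again after it. -/
theorem runEndsAt_prependSuccesses_of_false {x : ℕ → Bool} (h : x 0 = false) {s : ℕ} (hs : s < k)
    (n : ℕ) : RunEndsAt k (prependSuccesses s x) n ↔
      s + 1 ≤ n ∧ RunEndsAt k (fun t => x (t + 1)) (n - (s + 1)) := by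
  have hval : ∀ t, prependSuccesses s x (s + 1 + t) = x (t + 1) := fun t => by
    simp only [prependSuccesses]
    rw [if_neg (by omega)]
    congr 1
    omega
  have hfail : prependSuccesses s x s = false := by simp [prependSuccesses, h]
  constructor
  · rintro ⟨h1, h2⟩
    have h3 : s + 1 + k ≤ n := by
      by_contra hlt
      have := h2 s (by omega) (by omega)
      rw [hfail] at this
      exact Bool.noConfusion this
    refine ⟨by omega, by omega, fun t ht1 ht2 => ?_⟩
    exact (hval t).symm.trans (h2 _ (by omega) (by omega))
  · rintro ⟨h1, h2, h3⟩
    refine ⟨by omega, fun t ht1 ht2 => ?_⟩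
    obtain ⟨u, rfl⟩ : ∃ u, t = s + 1 + u := ⟨t - (s + 1), by omega⟩
    rw [hval]
    exact h3 u (by omega) (by omega)

/-- Only for positive counts: the time for zero runs is 0 and is not delayed. -/
theorem overlapRunTime_succ_eq_natCast_add {x y : ℕ → Bool} {d : ℕ}
    (h : ∀ n, RunEndsAt k y n ↔ d ≤ n ∧ RunEndsAt k x (n - d)) (r : ℕ) :
    overlapRunTime k ℓ y (r + 1) = d + overlapRunTime k ℓ x (r + 1) := by
  induction r with
  | zero =>
    rw [zero_add, overlapRunTime_one, overlapRunTime_one]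
    exact leastTime_eq_natCast_add h
  | succ r ih =>
    rw [overlapRunTime_succ k ℓ y, overlapRunTime_succ k ℓ x, ih]
    refine leastTime_eq_natCast_add fun n => ?_
    rw [h, and_assoc]
    refine and_congr_right fun hn => and_congr_right fun _ => ?_
    have h1 : (n : ℕ∞) = d + (n - d : ℕ) := by exact_mod_cast (Nat.add_sub_cancel' hn).symm
    rw [h1, add_assoc, ENat.add_le_add_iff_left (ENat.natCast_ne_top d)]

theorem overlapRunTime_one_prependSuccesses (x : ℕ → Bool) :
    overlapRunTime k ℓ (prependSuccesses k x) 1 = k := by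
  apply le_antisymm _ (le_overlapRunTime_succ _ _ _ _)
  rw [overlapRunTime_one]
  exact leastTime_le ⟨le_rfl, fun t _ ht => by simp [prependSuccesses, ht]⟩

/-- After the first counted run, `ℓ` of its successes remain available. -/
theorem overlapRunTime_prependSuccesses_add_two (hℓ : ℓ < k) (x : ℕ → Bool) (r : ℕ) :
    overlapRunTime k ℓ (prependSuccesses k x) (r + 2) =
      (k - ℓ : ℕ) + overlapRunTime k ℓ (prependSuccesses ℓ x) (r + 1) := by
  have hval : ∀ t, prependSuccesses k x (k - ℓ + t) = prependSuccesses ℓ x t := fun t => by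
    simp only [prependSuccesses]
    by_cases ht : t < ℓ
    · rw [if_pos ht, if_pos (by omega)]
    · rw [if_neg ht, if_neg (by omega)]
      congr 1
      omega
  -- For these n the window of k trials avoids the first k - ℓ positions; the gap condition excludes
  -- smaller n.
  have hrun : ∀ n, k - ℓ + k ≤ n → (RunEndsAt k (prependSuccesses k x) n ↔
      RunEndsAt k (prependSuccesses ℓ x) (n - (k - ℓ))) := fun n hn => by
    constructor
    · rintro ⟨h1, h2⟩
      refine ⟨by omega, fun t ht1 ht2 => ?_⟩
      rw [← hval]
      exact h2 _ (by omega) (by omega)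
    · rintro ⟨h1, h2⟩
      refine ⟨by omega, fun t ht1 ht2 => ?_⟩
      obtain ⟨u, rfl⟩ : ∃ u, t = k - ℓ + u := ⟨t - (k - ℓ), by omega⟩
      rw [hval]
      exact h2 u (by omega) (by omega)
  induction r with
  | zero =>
    rw [overlapRunTime_succ, zero_add, overlapRunTime_one_prependSuccesses, overlapRunTime_one]
    refine leastTime_eq_natCast_add fun n => ?_
    constructor
    · rintro ⟨h1, h2⟩
      have h3 : k + (k - ℓ) ≤ n := by exact_mod_cast h2
      exact ⟨by omega, (hrun n (by omega)).1 h1⟩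
    · rintro ⟨h1, h2⟩
      have h3 := h2.1
      refine ⟨(hrun n (by omega)).2 h2, ?_⟩
      have h4 : k + (k - ℓ) ≤ n := by omega
      exact_mod_cast h4
  | succ r ih =>
    rw [overlapRunTime_succ k ℓ _ (r + 2), ih, overlapRunTime_succ k ℓ _ (r + 1)]
    have hle := le_overlapRunTime_succ k ℓ (prependSuccesses ℓ x) r
    have hadd : ∀ n, k - ℓ ≤ n → ((k - ℓ : ℕ) + overlapRunTime k ℓ (prependSuccesses ℓ x) (r + 1) +
        ((k - ℓ : ℕ) : ℕ∞) ≤ n ↔ overlapRunTime k ℓ (prependSuccesses ℓ x) (r + 1) +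
        ((k - ℓ : ℕ) : ℕ∞) ≤ (n - (k - ℓ) : ℕ)) := fun n hn => by
      have h1 : (n : ℕ∞) = (k - ℓ : ℕ) + (n - (k - ℓ) : ℕ) := by
        exact_mod_cast (Nat.add_sub_cancel' hn).symm
      rw [h1, add_assoc, ENat.add_le_add_iff_left (ENat.natCast_ne_top _)]
    refine leastTime_eq_natCast_add fun n => ?_
    constructor
    · rintro ⟨h1, h2⟩
      have h3 : ((k - ℓ : ℕ) : ℕ∞) + k ≤ n := (by gcongr : ((k - ℓ : ℕ) : ℕ∞) + k ≤ _).trans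
        (le_self_add.trans h2)
      have h4 : k - ℓ + k ≤ n := by exact_mod_cast h3
      exact ⟨by omega, (hrun n h4).1 h1, (hadd n (by omega)).1 h2⟩
    · rintro ⟨h1, h2, h3⟩
      exact ⟨(hrun n (by have := h2.1; omega)).2 h2, (hadd n h1).2 h3⟩

/-- A failure discards the s + 1 trials up to it, a success lengthens the prefix, and a success that
completes a run leaves a prefix of length ℓ; each case is a translation of the waiting time. -/
theorem hitsAt_iff (hℓ : ℓ < k) (n s r : ℕ) (hs : s < k) (x : ℕ → Bool) :
    HitsAt k ℓ n s (r + 1) x ↔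
      overlapRunTime k ℓ (prependSuccesses s x) (r + 1) = (s + n : ℕ) := by
  induction n generalizing s r x with
  | zero =>
    simp only [HitsAt, add_zero, false_iff]
    intro h
    have h1 := le_overlapRunTime_succ k ℓ (prependSuccesses s x) r
    rw [h] at h1
    have h2 : k ≤ s := by exact_mod_cast h1
    omega
  | succ n ih =>
    rw [HitsAt]
    rcases hx : x 0 with _ | _
    · simp only [Bool.false_eq_true, false_and, true_and, false_or]
      rw [ih _ _ (by omega), prependSuccesses_zero, zero_add,
        overlapRunTime_succ_eq_natCast_add (runEndsAt_prependSuccesses_of_false hx hs),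
        show s + (n + 1) = s + 1 + n by ring, Nat.cast_add (s + 1) n,
        ENat.natCast_add_right_inj]
    · simp only [Bool.true_eq_false, false_and, true_and, or_false]
      rw [prependSuccesses_of_true hx]
      split_ifs with hsk
      · rw [hsk]
        rcases r with _ | r
        · rw [HitsAt, zero_add, overlapRunTime_one_prependSuccesses, Nat.cast_inj]
          omega
        · rw [ih _ _ hℓ, overlapRunTime_prependSuccesses_add_two hℓ,
            show s + (n + 1) = k - ℓ + (ℓ + n) by omega, Nat.cast_add (k - ℓ) (ℓ + n),
            ENat.natCast_add_right_inj]
      · rw [ih _ _ (by omega), show s + (n + 1) = s + 1 + n by ring]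

theorem overlapRunTime_eq_natCast_iff (hℓ : ℓ < k) {r : ℕ} (hr : 1 ≤ r) (x : ℕ → Bool) (n : ℕ) :
    overlapRunTime k ℓ x r = n ↔ HitsAt k ℓ n 0 r x := by
  obtain ⟨r, rfl⟩ := Nat.exists_eq_add_of_le' hr
  rw [hitsAt_iff hℓ n 0 r (by omega), prependSuccesses_zero, zero_add]

end Automaton

/-! ### Hitting probabilities and their recurrence -/

section HitProb

/-- The probability that exactly `n` trials are needed to count `r` runs when `s` successes are
available at the beginning. -/
noncomputable def hitProb (k ℓ : ℕ) (p : ℝ) : ℕ → ℕ → ℕ → ℝ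
  | n, _, 0 => if n = 0 then 1 else 0
  | 0, _, _ + 1 => 0
  | n + 1, s, r + 1 =>
    p * (if s + 1 = k then hitProb k ℓ p n ℓ r else hitProb k ℓ p n (s + 1) (r + 1)) +
      (1 - p) * hitProb k ℓ p n 0 (r + 1)

variable {k ℓ : ℕ} {p : ℝ}

theorem hitProb_nonneg (hp0 : 0 ≤ p) (hp1 : p ≤ 1) (n s r : ℕ) : 0 ≤ hitProb k ℓ p n s r := by
  induction n generalizing s r with
  | zero => rcases r with _ | r <;> simp [hitProb]
  | succ n ih =>
    rcases r with _ | r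
    · simp [hitProb]
    · have hq : 0 ≤ 1 - p := by linarith
      rw [hitProb]
      split_ifs
      · exact add_nonneg (mul_nonneg hp0 (ih _ _)) (mul_nonneg hq (ih _ _))
      · exact add_nonneg (mul_nonneg hp0 (ih _ _)) (mul_nonneg hq (ih _ _))

theorem sum_range_hitProb_le_one (hp0 : 0 ≤ p) (hp1 : p ≤ 1) (N s r : ℕ) :
    ∑ n ∈ Finset.range N, hitProb k ℓ p n s r ≤ 1 := by
  rcases r with _ | r
  · simp only [hitProb, Finset.sum_ite_eq']
    split_ifs <;> norm_num
  induction N generalizing s r with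
  | zero => simp
  | succ N ih =>
    rw [Finset.sum_range_succ']
    have hq : 0 ≤ 1 - p := by linarith
    -- Completing a run may leave no runs to count, a case outside the induction hypothesis.
    have h0 : ∀ s, ∑ n ∈ Finset.range N, hitProb k ℓ p n s r ≤ 1 := fun s => by
      rcases r with _ | r
      · simp only [hitProb, Finset.sum_ite_eq']
        split_ifs <;> norm_num
      · exact ih s r
    simp only [hitProb, add_zero, Finset.sum_add_distrib, ← Finset.mul_sum]
    have h1 := mul_le_mul_of_nonneg_left (ih 0 r) hq
    split_ifs
    · have h2 := mul_le_mul_of_nonneg_left (h0 ℓ) hp0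
      linarith
    · have h2 := mul_le_mul_of_nonneg_left (ih (s + 1) r) hp0
      linarith

theorem summable_hitProb (hp0 : 0 ≤ p) (hp1 : p ≤ 1) (s r : ℕ) :
    Summable fun n => hitProb k ℓ p n s r :=
  summable_of_sum_range_le (fun n => hitProb_nonneg hp0 hp1 n s r)
    fun N => sum_range_hitProb_le_one hp0 hp1 N s r

theorem tsum_hitProb_step (hp0 : 0 ≤ p) (hp1 : p ≤ 1) (s r : ℕ) :
    ∑' n, hitProb k ℓ p n s (r + 1) =
      p * (if s + 1 = k then ∑' n, hitProb k ℓ p n ℓ r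
        else ∑' n, hitProb k ℓ p n (s + 1) (r + 1)) +
      (1 - p) * ∑' n, hitProb k ℓ p n 0 (r + 1) := by
  rw [(summable_hitProb hp0 hp1 s (r + 1)).tsum_eq_zero_add]
  simp only [hitProb, zero_add]
  split_ifs
  · rw [Summable.tsum_add ((summable_hitProb hp0 hp1 _ _).mul_left _)
      ((summable_hitProb hp0 hp1 _ _).mul_left _), tsum_mul_left, tsum_mul_left]
  · rw [Summable.tsum_add ((summable_hitProb hp0 hp1 _ _).mul_left _)
      ((summable_hitProb hp0 hp1 _ _).mul_left _), tsum_mul_left, tsum_mul_left]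

/-- The total masses satisfy S_s = p S_(s+1) + q S_0 for s < k - 1, so all equal S_0; at s = k - 1,
S_0 = p + q S_0, since the mass with one run fewer is 1. -/
theorem tsum_hitProb (hp0 : 0 < p) (hp1 : p ≤ 1) (hℓ : ℓ < k) {s : ℕ} (hs : s < k) (r : ℕ) :
    ∑' n, hitProb k ℓ p n s r = 1 := by
  induction r generalizing s with
  | zero => simp [hitProb]
  | succ r ih =>
    have hconst : ∀ s, s < k →
        ∑' n, hitProb k ℓ p n s (r + 1) = ∑' n, hitProb k ℓ p n 0 (r + 1) := by
      intro s
      induction s with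
      | zero => exact fun _ => rfl
      | succ s ihs =>
        intro h
        have h1 := tsum_hitProb_step (k := k) (ℓ := ℓ) hp0.le hp1 s r
        rw [if_neg h.ne, ihs (by omega)] at h1
        refine mul_left_cancel₀ hp0.ne' ?_
        linear_combination -h1
    have h1 := tsum_hitProb_step (k := k) (ℓ := ℓ) hp0.le hp1 (k - 1) r
    rw [if_pos (by omega), ih hℓ, hconst (k - 1) (by omega)] at h1
    rw [hconst s hs]
    refine mul_left_cancel₀ hp0.ne' ?_
    linear_combination h1

theorem auxPoly_succ (k : ℕ) (p : ℝ) : auxPoly (k + 1) p =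
    Polynomial.X * auxPoly k p - Polynomial.C (((1 - p) * p ^ k : ℝ) : ℂ) := by
  rw [auxPoly, auxPoly, Finset.sum_range_succ, mul_sub, Finset.mul_sum, ← pow_succ', sub_sub]
  congr 2
  · refine Finset.sum_congr rfl fun j hj => ?_
    rw [Finset.mem_range] at hj
    rw [mul_left_comm, ← pow_succ']
    congr 2
    omega
  · simp

open Polynomial in
/-- The hitting probabilities from the state `s` in terms of those from the state `0`. -/
theorem pow_smul_hitProb (ℓ : ℕ) (hk : 0 < k) (r s : ℕ) (hs : s ≤ k) :
    (p : ℂ) ^ s • (fun n => ((if s = k then hitProb k ℓ p n ℓ r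
      else hitProb k ℓ p n s (r + 1) : ℝ) : ℂ)) =
      aeval seqShift (auxPoly s p) fun n => (hitProb k ℓ p n 0 (r + 1) : ℂ) := by
  induction s with
  | zero => simp [auxPoly, hk.ne]
  | succ s ih =>
    have hsk : s ≠ k := by omega
    have h := ih (by omega)
    rw [auxPoly_succ, map_sub, map_mul, aeval_X, LinearMap.sub_apply, Module.End.mul_apply, ← h]
    funext n
    simp only [if_neg hsk, aeval_C, Module.algebraMap_end_apply, Pi.sub_apply, Pi.smul_apply,
      smul_eq_mul, map_smul]
    change _ = (p : ℂ) ^ s * (hitProb k ℓ p (n + 1) s (r + 1) : ℂ) - _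
    rw [hitProb]
    push_cast
    ring

/-- Induction along the restarts in state ℓ: polynomials in the shift commute, and each factor
A_k(E) lowers r by one. The factor X annihilates the final sequence, the indicator of n = 0. -/
theorem aeval_auxPoly_pow_shift_hitProb (hp0 : p ≠ 0) (hℓ : ℓ < k) (r : ℕ) :
    Polynomial.aeval seqShift (auxPoly k p ^ r * Polynomial.X)
      (fun n => (hitProb k ℓ p n ℓ r : ℂ)) = 0 := by
  have hpC : (p : ℂ) ≠ 0 := by exact_mod_cast hp0
  induction r with
  | zero =>
    funext n
    simp [seqShift, hitProb]
  | succ r ih =>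
    have h1 := pow_smul_hitProb (p := p) ℓ (by omega) r k le_rfl
    have h2 := pow_smul_hitProb (p := p) ℓ (by omega) r ℓ hℓ.le
    simp only [if_true, if_neg hℓ.ne] at h1 h2
    refine (smul_eq_zero_iff_right (pow_ne_zero ℓ hpC)).1 ?_
    rw [← map_smul, h2, ← Module.End.mul_apply, ← map_mul,
      show auxPoly k p ^ (r + 1) * Polynomial.X * auxPoly ℓ p =
        auxPoly ℓ p * (auxPoly k p ^ r * Polynomial.X) * auxPoly k p by ring,
      map_mul, map_mul, Module.End.mul_apply, ← h1, map_smul, Module.End.mul_apply, ih]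
    simp

/-- The mass function of the waiting time, from `n = 1` on, satisfies the linear recurrence with
characteristic polynomial `auxPoly k p ^ r`. -/
theorem aeval_auxPoly_pow_hitProb_zero (hp0 : p ≠ 0) (hℓ : ℓ < k) {r : ℕ} (hr : 1 ≤ r) :
    Polynomial.aeval seqShift (auxPoly k p ^ r) (fun n => (hitProb k ℓ p (n + 1) 0 r : ℂ)) = 0 := by
  obtain ⟨r, rfl⟩ := Nat.exists_eq_add_of_le' hr
  have h1 := pow_smul_hitProb (p := p) ℓ (by omega) r k le_rfl
  simp only [if_true] at h1
  have h2 : (fun n => (hitProb k ℓ p (n + 1) 0 (r + 1) : ℂ)) =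
      Polynomial.aeval seqShift (Polynomial.X : Polynomial ℂ) fun n => (hitProb k ℓ p n 0 (r + 1) : ℂ) := by
    rw [Polynomial.aeval_X]
    rfl
  rw [h2, ← Module.End.mul_apply, ← map_mul,
    show auxPoly k p ^ (r + 1) * Polynomial.X =
      auxPoly k p ^ r * Polynomial.X * auxPoly k p by ring,
    map_mul, Module.End.mul_apply, ← h1, map_smul, aeval_auxPoly_pow_shift_hitProb hp0 hℓ, smul_zero]

end HitProb

/-! ### From the trials to the hitting probabilities -/

section Probability

variable {Ω : Type*} [MeasurableSpace Ω] {P : Measure Ω} {p : ℝ}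
  {X : ℕ → Ω → Bool} {k ℓ : ℕ}

/-- The `σ`-algebra of the trials from index `t` on. -/
abbrev futureTrials {Ω : Type*} (X : ℕ → Ω → Bool) (t : ℕ) : MeasurableSpace Ω :=
  ⨆ i ∈ Set.Ici t, MeasurableSpace.comap (X i) inferInstance

theorem futureTrials_antitone {Ω : Type*} (X : ℕ → Ω → Bool) : Antitone (futureTrials X) :=
  fun _ _ h => biSup_mono fun _ hi => le_trans h hi

theorem futureTrials_le (hX : ∀ t, Measurable (X t)) (t : ℕ) :
    futureTrials X t ≤ (inferInstance : MeasurableSpace Ω) :=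
  iSup₂_le fun i _ => (hX i).comap_le

theorem setOf_hitsAt_succ {Ω : Type*} (X : ℕ → Ω → Bool) (n s r t : ℕ) :
    {ω | HitsAt k ℓ (n + 1) s (r + 1) fun u => X (t + u) ω} =
      (X t ⁻¹' {true} ∩ if s + 1 = k then {ω | HitsAt k ℓ n ℓ r fun u => X (t + 1 + u) ω}
        else {ω | HitsAt k ℓ n (s + 1) (r + 1) fun u => X (t + 1 + u) ω}) ∪
      (X t ⁻¹' {false} ∩ {ω | HitsAt k ℓ n 0 (r + 1) fun u => X (t + 1 + u) ω}) := by
  ext ω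
  have h : (fun u => X (t + (u + 1)) ω) = fun u => X (t + 1 + u) ω := by
    funext u
    rw [add_right_comm, add_assoc]
  split_ifs with hs <;> simp [HitsAt, hs, h]

theorem measurableSet_hitsAt {Ω : Type*} (X : ℕ → Ω → Bool) (n s r t : ℕ) :
    MeasurableSet[futureTrials X t] {ω | HitsAt k ℓ n s r fun u => X (t + u) ω} := by
  induction n generalizing s r t with
  | zero =>
    rcases r with _ | r
    · simp [HitsAt]
    · simp [HitsAt]
  | succ n ih =>
    rcases r with _ | r
    · simp [HitsAt]
    · rw [setOf_hitsAt_succ]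
      have hle : futureTrials X (t + 1) ≤ futureTrials X t := futureTrials_antitone X (Nat.le_succ t)
      have hcur : ∀ b : Bool, MeasurableSet[futureTrials X t] (X t ⁻¹' {b}) := fun b =>
        le_biSup (fun i => MeasurableSpace.comap (X i) inferInstance) (Set.mem_Ici.2 le_rfl) _
          ⟨{b}, measurableSet_singleton b, rfl⟩
      refine MeasurableSet.union (MeasurableSet.inter (hcur _) ?_)
        (MeasurableSet.inter (hcur _) (hle _ (ih _ _ _)))
      split_ifs
      · exact hle _ (ih _ _ _)
      · exact hle _ (ih _ _ _)

theorem indep_comap_futureTrials (hX : ∀ t, Measurable (X t)) (hind : iIndepFun X P) (t : ℕ) :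
    Indep (MeasurableSpace.comap (X t) inferInstance) (futureTrials X (t + 1)) P := by
  have h := indep_iSup_of_disjoint (S := {t}) (T := Set.Ici (t + 1)) (fun i => (hX i).comap_le)
    hind (by simp)
  simpa [futureTrials] using h

theorem measureReal_preimage_inter (hX : ∀ t, Measurable (X t)) (hind : iIndepFun X P) (t : ℕ)
    (b : Bool) {A : Set Ω} (hA : MeasurableSet[futureTrials X (t + 1)] A) :
    P.real (X t ⁻¹' {b} ∩ A) = P.real (X t ⁻¹' {b}) * P.real A := by
  have h := (Indep_iff _ _ P).1 (indep_comap_futureTrials hX hind t) (X t ⁻¹' {b}) A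
    ⟨{b}, measurableSet_singleton b, rfl⟩ hA
  rw [measureReal_def, h, ENNReal.toReal_mul]
  rfl

/-- Trial t is independent of the later ones, on which the remaining event depends; an arbitrary
starting index t lets the induction pass to t + 1. -/
theorem measureReal_hitsAt [IsProbabilityMeasure P]
    (hX : ∀ t, Measurable (X t)) (hind : iIndepFun X P)
    (hXp : ∀ t, P.real {ω | X t ω = true} = p) (n s r t : ℕ) :
    P.real {ω | HitsAt k ℓ n s r fun u => X (t + u) ω} = hitProb k ℓ p n s r := by
  induction n generalizing s r t with
  | zero => rcases r with _ | r <;> simp [HitsAt, hitProb]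
  | succ n ih =>
    rcases r with _ | r
    · simp [HitsAt, hitProb]
    · have htrue : P.real (X t ⁻¹' {true}) = p := hXp t
      have hfalse : P.real (X t ⁻¹' {false}) = 1 - p := by
        rw [← htrue, ← probReal_compl_eq_one_sub (hX t (measurableSet_singleton true))]
        congr 1
        ext ω
        simp
      have hm : ∀ s r, MeasurableSet[futureTrials X (t + 1)]
        {ω | HitsAt k ℓ n s r fun u => X (t + 1 + u) ω} :=
        fun s r => measurableSet_hitsAt X n s r (t + 1)
      rw [setOf_hitsAt_succ, measureReal_union, measureReal_preimage_inter hX hind t false (hm _ _),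
        hfalse, ih, hitProb]
      · congr 1
        split_ifs
        · rw [measureReal_preimage_inter hX hind t true (hm _ _), htrue, ih]
        · rw [measureReal_preimage_inter hX hind t true (hm _ _), htrue, ih]
      · rw [Set.disjoint_left]
        rintro ω ⟨h1, -⟩ ⟨h2, -⟩
        simp_all
      · exact (hX t (measurableSet_singleton false)).inter (futureTrials_le hX _ _ (hm _ _))

theorem measurableSet_nbTime_eq (hX : ∀ t, Measurable (X t)) (hℓ : ℓ < k) {r : ℕ} (hr : 1 ≤ r)
    (n : ℕ) : MeasurableSet {ω | nbTime X k r ℓ ω = n} := by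
  have h := futureTrials_le hX 0 _ (measurableSet_hitsAt (k := k) (ℓ := ℓ) X n 0 r 0)
  simpa only [nbTime, overlapRunTime_eq_natCast_iff hℓ hr, zero_add] using h

theorem nbPMF_eq_hitProb [IsProbabilityMeasure P]
    (hX : ∀ t, Measurable (X t)) (hind : iIndepFun X P)
    (hXp : ∀ t, P.real {ω | X t ω = true} = p) (hℓ : ℓ < k) {r : ℕ} (hr : 1 ≤ r) (n : ℕ) :
    nbPMF P X k r ℓ n = hitProb k ℓ p n 0 r := by
  rw [← measureReal_hitsAt hX hind hXp n 0 r 0]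
  simp only [nbPMF, nbTime, overlapRunTime_eq_natCast_iff hℓ hr, zero_add]

theorem ae_nbTime_ne_top [IsProbabilityMeasure P]
    (hX : ∀ t, Measurable (X t)) (hind : iIndepFun X P)
    (hXp : ∀ t, P.real {ω | X t ω = true} = p) (hp0 : 0 < p) (hp1 : p ≤ 1) (hℓ : ℓ < k) {r : ℕ}
    (hr : 1 ≤ r) : ∀ᵐ ω ∂P, nbTime X k r ℓ ω ≠ ⊤ := by
  have hunion : {ω | nbTime X k r ℓ ω ≠ ⊤} = ⋃ n : ℕ, {ω | nbTime X k r ℓ ω = n} := by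
    ext ω
    simp [ENat.ne_top_iff_exists, eq_comm]
  have hmeas := measurableSet_nbTime_eq hX hℓ hr
  have hone : P {ω | nbTime X k r ℓ ω ≠ ⊤} = 1 := by
    have h1 : ∀ n : ℕ, P {ω | nbTime X k r ℓ ω = n} = ENNReal.ofReal (hitProb k ℓ p n 0 r) :=
      fun n => by
        rw [← nbPMF_eq_hitProb hX hind hXp hℓ hr, nbPMF, ofReal_measureReal]
    rw [hunion, measure_iUnion _ hmeas, tsum_congr h1, ← ENNReal.ofReal_tsum_of_nonneg
      (fun n => hitProb_nonneg hp0.le hp1 n 0 r) (summable_hitProb hp0.le hp1 0 r),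
      tsum_hitProb hp0 hp1 hℓ (by omega), ENNReal.ofReal_one]
    intro m n hmn
    simp only [Function.onFun]
    rw [Set.disjoint_left]
    intro ω h1 h2
    exact hmn (by exact_mod_cast h1.symm.trans h2)
  exact (prob_compl_eq_zero_iff (hunion ▸ MeasurableSet.iUnion hmeas)).2 hone

theorem measurable_toNat_nbTime (hX : ∀ t, Measurable (X t)) (hℓ : ℓ < k) {r : ℕ} (hr : 1 ≤ r) :
    Measurable fun ω => (nbTime X k r ℓ ω).toNat := by
  have hmeas := measurableSet_nbTime_eq hX hℓ hr
  have htop : MeasurableSet {ω | nbTime X k r ℓ ω = ⊤} := by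
    have : {ω | nbTime X k r ℓ ω = ⊤} = (⋃ n : ℕ, {ω | nbTime X k r ℓ ω = n})ᶜ := by
      ext ω
      have := ENat.ne_top_iff_exists (n := nbTime X k r ℓ ω)
      simp only [Set.mem_compl_iff, Set.mem_iUnion, Set.mem_ofPred_eq]
      rw [← not_iff_not, not_not, ← ne_eq, this]
      simp [eq_comm]
    rw [this]
    exact (MeasurableSet.iUnion hmeas).compl
  refine measurable_to_countable' fun n => ?_
  rcases n with _ | n
  -- `ENat.toNat` sends `⊤` to 0.
  · convert (hmeas 0).union htop using 1
    ext ω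
    simp [ENat.toNat_eq_zero]
  · convert hmeas (n + 1) using 1
    ext ω
    simp only [Set.mem_preimage, Set.mem_singleton_iff, Set.mem_ofPred_eq]
    exact ENat.toNat_eq_iff (Nat.succ_ne_zero n)

theorem map_toNat_nbTime_real_singleton [IsProbabilityMeasure P]
    (hX : ∀ t, Measurable (X t)) (hind : iIndepFun X P)
    (hXp : ∀ t, P.real {ω | X t ω = true} = p) (hp0 : 0 < p) (hp1 : p ≤ 1) (hℓ : ℓ < k) {r : ℕ}
    (hr : 1 ≤ r) (n : ℕ) :
    (P.map fun ω => (nbTime X k r ℓ ω).toNat).real {n} = nbPMF P X k r ℓ n := by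
  rw [map_measureReal_apply (measurable_toNat_nbTime hX hℓ hr) (measurableSet_singleton n), nbPMF]
  refine measureReal_congr ?_
  filter_upwards [ae_nbTime_ne_top hX hind hXp hp0 hp1 hℓ hr] with ω hω
  obtain ⟨m, hm⟩ := ENat.ne_top_iff_exists.1 hω
  refine propext ?_
  change (nbTime X k r ℓ ω).toNat = n ↔ nbTime X k r ℓ ω = n
  rw [← hm, ENat.toNat_natCast, Nat.cast_inj]

theorem integrable_nbFalling_of_summable [IsProbabilityMeasure P]
    (hX : ∀ t, Measurable (X t)) (hind : iIndepFun X P)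
    (hXp : ∀ t, P.real {ω | X t ω = true} = p) (hp0 : 0 < p) (hp1 : p ≤ 1) (hℓ : ℓ < k) {r : ℕ}
    (hr : 1 ≤ r) {i : ℕ} (h : Summable fun n : ℕ => (n.descFactorial i : ℝ) * nbPMF P X k r ℓ n) :
    Integrable (nbFalling X k r ℓ i) P ∧
      nbFactorialMoment P X k r ℓ i = ∑' n : ℕ, (n.descFactorial i : ℝ) * nbPMF P X k r ℓ n := by
  set Y : Ω → ℕ := fun ω => (nbTime X k r ℓ ω).toNat with hY
  have hYm : Measurable Y := measurable_toNat_nbTime hX hℓ hr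
  have hlaw := map_toNat_nbTime_real_singleton hX hind hXp hp0 hp1 hℓ hr
  rw [← hY] at hlaw
  have := Measure.isProbabilityMeasure_map hYm.aemeasurable (μ := P)
  have hint : Integrable (fun n : ℕ => (n.descFactorial i : ℝ)) (P.map Y) := by
    refine ⟨measurable_from_nat.aestronglyMeasurable, ?_⟩
    rw [HasFiniteIntegral, lintegral_countable']
    have hterm : ∀ n : ℕ, ‖(n.descFactorial i : ℝ)‖ₑ * (P.map Y) {n} =
        ENNReal.ofReal ((n.descFactorial i : ℝ) * nbPMF P X k r ℓ n) := fun n => by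
      rw [← hlaw, ENNReal.ofReal_mul (Nat.cast_nonneg _), ofReal_measureReal,
        Real.enorm_of_nonneg (Nat.cast_nonneg _)]
    have hnn : ∀ n : ℕ, 0 ≤ (n.descFactorial i : ℝ) * nbPMF P X k r ℓ n := fun n =>
      mul_nonneg (Nat.cast_nonneg _) measureReal_nonneg
    rw [tsum_congr hterm, ← ENNReal.ofReal_tsum_of_nonneg hnn h]
    exact ENNReal.ofReal_lt_top
  refine ⟨hint.comp_measurable hYm, ?_⟩
  change ∫ ω, ((Y ω).descFactorial i : ℝ) ∂P = _
  rw [← integral_map (f := fun n : ℕ => (n.descFactorial i : ℝ)) hYm.aemeasurable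
    measurable_from_nat.aestronglyMeasurable, integral_countable hint]
  simp only [hlaw, smul_eq_mul, mul_comm]

end Probability

/-! ### Root expansion and moment series -/

section Expansion

theorem exists_isRootExpansion {k ℓ r : ℕ} {p : ℝ} (hp0 : 0 < p) (hp1 : p < 1) (hℓ : ℓ < k)
    (hr : 1 ≤ r) {lam : Fin k → ℂ}
    (hlam : auxPoly k p = ∏ j : Fin k, (Polynomial.X - Polynomial.C (lam j))) :
    ∃ a : Fin k → ℕ → ℂ, IsRootExpansion r lam (fun n => hitProb k ℓ p n 0 r) a := by
  have h := aeval_auxPoly_pow_hitProb_zero hp0.ne' hℓ hr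
  rw [hlam, ← Finset.prod_pow] at h
  obtain ⟨a, ha⟩ := exists_eq_sum_of_aeval_prod_eq_zero Finset.univ
    (injective_of_auxPoly_eq_prod hlam hp0 hp1) r _ h
  refine ⟨a, fun n hn => ?_⟩
  obtain ⟨n, rfl⟩ := Nat.exists_eq_add_of_le' hn
  exact ha n

theorem hasSum_descFactorial_mul_of_isRootExpansion {k r : ℕ} {lam : Fin k → ℂ} {f : ℕ → ℝ}
    {a : Fin k → ℕ → ℂ} (hlt : ∀ j, ‖lam j‖ < 1) (hne : ∀ j, lam j ≠ 0)
    (ha : IsRootExpansion r lam f a) {i : ℕ} (hi : 1 ≤ i) :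
    HasSum (fun n : ℕ => ((n.descFactorial i * f n : ℝ) : ℂ))
      (∑ j : Fin k, ∑ m ∈ Finset.Icc 1 r, a j m *
        (i.factorial * (lam j ^ i / (1 - lam j) ^ (i + m) * ∑ b ∈ Finset.Icc 1 m,
          (m.choose b : ℂ) * ((i - 1).choose (b - 1) : ℂ) * (lam j ^ b)⁻¹))) := by
  have h : HasSum (fun n : ℕ => ∑ j : Fin k, ∑ m ∈ Finset.Icc 1 r, a j m *
      ((n.descFactorial i : ℂ) * (((n - 1).choose (m - 1) : ℂ) * lam j ^ (n - m)))) _ :=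
    hasSum_sum fun j _ => hasSum_sum fun m hm =>
      (hasSum_descFactorial_mul_choose_mul_pow (hlt j) (hne j) hi (Finset.mem_Icc.1 hm).1).mul_left
        (a j m)
  refine (congrArg (HasSum · _) (funext fun n => ?_)).mpr h
  -- The expansion is not asserted at n = 0, where the falling factorial vanishes because i ≥ 1.
  rcases Nat.eq_zero_or_pos n with rfl | hn
  · obtain ⟨i, rfl⟩ := Nat.exists_eq_add_of_le' hi
    simp
  · rw [Complex.ofReal_mul, ha n hn, Complex.ofReal_natCast, Finset.mul_sum]
    refine Finset.sum_congr rfl fun j _ => ?_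
    rw [Finset.mul_sum]
    exact Finset.sum_congr rfl fun m _ => by ring

/-- The sum of the factorial moment series, by `x ^ k * (1 - x) = c`. -/
theorem pow_div_one_sub_pow_eq {x c : ℂ} {k : ℕ} (hx : x ≠ 0) (hc : c ≠ 0)
    (h : x ^ k * (1 - x) = c) (i m : ℕ) :
    x ^ i / (1 - x) ^ (i + m) = x ^ ((i + m) * k + i) / c ^ m / c ^ i := by
  have h1 : 1 - x ≠ 0 := right_ne_zero_of_mul (h ▸ hc)
  have h2 : x ^ k ≠ 0 := pow_ne_zero _ hx
  rw [div_div, ← pow_add, add_comm m i, ← h, mul_pow, pow_add _ _ i, mul_comm (i + m) k, pow_mul]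
  field_simp

end Expansion

theorem mainTheorem6 {Ω : Type*} [MeasurableSpace Ω] (P : Measure Ω) [IsProbabilityMeasure P]
    (p : ℝ) (hp0 : 0 < p) (hp1 : p < 1)
    (X : ℕ → Ω → Bool) (hXmeas : ∀ t, Measurable (X t)) (hXindep : iIndepFun X P)
    (hXp : ∀ t, P.real {ω | X t ω = true} = p)
    (k r ℓ : ℕ) (hr : 1 ≤ r) (hℓ : ℓ < k)
    (lam : Fin k → ℂ)
    (hlam : auxPoly k p = ∏ j : Fin k, (Polynomial.X - Polynomial.C (lam j))) :
    -- the roots are distinct and lie in the punctured open unit disc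
    Function.Injective lam ∧ (∀ j, lam j ≠ 0 ∧ ‖lam j‖ < 1) ∧
    -- the waiting time is almost surely finite, and its factorial moments exist
    (∀ᵐ ω ∂P, nbTime X k r ℓ ω ≠ ⊤) ∧
    (∀ i : ℕ, Integrable (nbFalling X k r ℓ i) P) ∧
    -- coefficients `a j m` exist
    (∃ a : Fin k → ℕ → ℂ, IsRootExpansion r lam (nbPMF P X k r ℓ) a) ∧
    -- the factorial moments as finite sums over the roots
    (∀ a : Fin k → ℕ → ℂ, IsRootExpansion r lam (nbPMF P X k r ℓ) a → ∀ i : ℕ, 1 ≤ i →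
      (nbFactorialMoment P X k r ℓ i : ℂ) =
          (i.factorial : ℂ) / ((1 - p : ℂ) * (p : ℂ) ^ k) ^ i *
            ∑ j : Fin k, ∑ m ∈ Finset.Icc 1 r,
              a j m * (lam j ^ ((i + m) * k + i) / ((1 - p : ℂ) * (p : ℂ) ^ k) ^ m) *
                ∑ b ∈ Finset.Icc 1 m,
                  (m.choose b : ℂ) * ((i - 1).choose (b - 1) : ℂ) * (lam j ^ b)⁻¹ ∧
      (nbFactorialMoment P X k r ℓ i : ℂ) =
          (i.factorial : ℂ) / ((1 - p : ℂ) * (p : ℂ) ^ k) ^ i *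
            ∑ j : Fin k, ∑ m ∈ Finset.Icc 1 r,
              a j m *
                ((m : ℂ) * lam j ^ ((i + m) * k + i - 1) / ((1 - p : ℂ) * (p : ℂ) ^ k) ^ m) *
                  ordinaryHypergeometric (1 - m : ℂ) (1 - i : ℂ) (2 : ℂ) (1 / lam j)) ∧
    -- the case `ℓ = k - 1` is the waiting time of Type III
    (ℓ = k - 1 → ∀ ω, nbTime X k r ℓ ω = typeIIIRunTime k (fun t => X t ω) r) ∧
    -- the case `r = 1`
    (r = 1 → ∀ i : ℕ, 1 ≤ i →
      nbFactorialMoment P X k r ℓ i =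
        (i.factorial : ℝ) / ((1 - p) * p ^ k) ^ (i + 1) * geomPMF P X k ((i + 1) * k + i)) := by
  have hroot := auxPoly_isRoot_of_eq_prod hlam
  have hinj := injective_of_auxPoly_eq_prod hlam hp0 hp1
  have hne : ∀ j, lam j ≠ 0 := fun j => ne_zero_of_auxPoly_isRoot hp0 hp1 (by omega) (hroot j)
  have hlt : ∀ j, ‖lam j‖ < 1 := fun j => norm_lt_one_of_auxPoly_isRoot hp0 hp1 (hroot j)
  have hpmf : nbPMF P X k r ℓ = fun n => hitProb k ℓ p n 0 r :=
    funext fun n => nbPMF_eq_hitProb hXmeas hXindep hXp hℓ hr n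
  have hexists : ∃ a : Fin k → ℕ → ℂ, IsRootExpansion r lam (nbPMF P X k r ℓ) a := by
    rw [hpmf]
    exact exists_isRootExpansion hp0 hp1 hℓ hr hlam
  have hsummable : ∀ i : ℕ, 1 ≤ i →
      Summable fun n : ℕ => (n.descFactorial i : ℝ) * nbPMF P X k r ℓ n := by
    intro i hi
    obtain ⟨a, ha⟩ := hexists
    exact Complex.summable_ofReal.1
      (hasSum_descFactorial_mul_of_isRootExpansion hlt hne ha hi).summable
  have hintegrable := fun {i : ℕ} => integrable_nbFalling_of_summable hXmeas hXindep hXp hp0 hp1.le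
    hℓ hr (i := i)
  set c : ℂ := (1 - p : ℂ) * (p : ℂ) ^ k with hc
  have hc0 : c ≠ 0 := by
    have h : (1 - p) * p ^ k ≠ 0 := mul_ne_zero (by linarith) (by positivity)
    rw [hc]
    exact_mod_cast h
  have hmoment : ∀ a : Fin k → ℕ → ℂ, IsRootExpansion r lam (nbPMF P X k r ℓ) a → ∀ i : ℕ, 1 ≤ i →
      (nbFactorialMoment P X k r ℓ i : ℂ) =
        (i.factorial : ℂ) / c ^ i * ∑ j : Fin k, ∑ m ∈ Finset.Icc 1 r,
          a j m * (lam j ^ ((i + m) * k + i) / c ^ m) * ∑ b ∈ Finset.Icc 1 m,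
            (m.choose b : ℂ) * ((i - 1).choose (b - 1) : ℂ) * (lam j ^ b)⁻¹ := by
    intro a ha i hi
    rw [(hintegrable (hsummable i hi)).2, Complex.ofReal_tsum,
      (hasSum_descFactorial_mul_of_isRootExpansion hlt hne ha hi).tsum_eq, Finset.mul_sum]
    refine Finset.sum_congr rfl fun j _ => ?_
    rw [Finset.mul_sum]
    refine Finset.sum_congr rfl fun m _ => ?_
    rw [pow_div_one_sub_pow_eq (hne j) hc0 (pow_mul_one_sub_of_isRoot (hroot j))]
    ring
  refine ⟨hinj, fun j => ⟨hne j, hlt j⟩, ae_nbTime_ne_top hXmeas hXindep hXp hp0 hp1.le hℓ hr,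
    fun i => ?_, hexists, fun a ha i hi => ⟨hmoment a ha i hi, ?_⟩, ?_, ?_⟩
  · rcases Nat.eq_zero_or_pos i with rfl | hi
    · have h : nbFalling X k r ℓ 0 = fun _ => (1 : ℝ) := by
        funext ω
        simp [nbFalling]
      rw [h]
      exact integrable_const 1
    · exact (hintegrable (hsummable i hi)).1
  · rw [hmoment a ha i hi]
    congr 1
    refine Finset.sum_congr rfl fun j _ => Finset.sum_congr rfl fun m hm => ?_
    rw [← natCast_mul_ordinaryHypergeometric hi (Finset.mem_Icc.1 hm).1]
    -- The exponent is positive, so one factor `lam j` can absorb the inverse in the hypergeometric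
    -- identity.
    obtain ⟨e, he⟩ : ∃ e, (i + m) * k + i = e + 1 := ⟨(i + m) * k + i - 1, by omega⟩
    have h : lam j ^ (e + 1) * (lam j)⁻¹ = lam j ^ e := by
      rw [pow_succ, mul_inv_cancel_right₀ (hne j)]
    rw [he, Nat.add_sub_cancel, ← h]
    ring
  · rintro rfl ω
    exact overlapRunTime_pred_eq_typeIIIRunTime (by omega) _ r
  · rintro rfl i hi
    obtain ⟨a, ha⟩ := hexists
    have hgeom : geomPMF P X k = nbPMF P X k 1 ℓ := by
      funext n
      simp only [geomPMF, nbPMF, nbTime, overlapRunTime_one_eq_firstRunTime]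
    have h := hmoment a ha i hi
    have hn : 1 ≤ (i + 1) * k + i := by omega
    rw [← Complex.ofReal_inj, h, hgeom]
    push_cast
    -- Only m = b = 1 occurs, and its power of `lam j` has exponent n - 1 with n = (i + 1)k + i, as
    -- in the expansion at n.
    rw [ha _ hn, ← hc, pow_succ, Finset.mul_sum, Finset.mul_sum]
    refine Finset.sum_congr rfl fun j _ => ?_
    obtain ⟨e, he⟩ : ∃ e, (i + 1) * k + i = e + 1 := ⟨(i + 1) * k + i - 1, by omega⟩
    have hj := hne j
    simp only [Finset.Icc_self, Finset.sum_singleton, Nat.sub_self, Nat.choose_zero_right,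
      Nat.choose_self, Nat.cast_one, one_mul, he, Nat.add_sub_cancel, pow_succ]
    field_simp
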